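/- Let $\mathcal H$ be a separable infinite-dimensional complex Hilbert space, $B(\mathcal H)$ the bounded linear operators on $\mathcal H$ and $B(\mathcal H)_+$ the positive ones. For a compact operator $x$ let $\mu_1(x)\ge\mu_2(x)\ge\dots$ be the eigenvalues of $|x|=\sqrt{x^*x}$ in decreasing order, each non-zero eigenvalue repeated according to its multiplicity (padded by zeros if $x$ has finite rank), and put $\sigma_n(x)=\sum_{j\le n}\mu_j(x)$ and $\gamma_n(x)=\sigma_n(x)/\log n$ for $n\ge 2$. Let $$L^{1,\infty}(\mathcal H)=\{x \text{ compact}:\ \sup_{n\ge 2}\gamma_n(x)<\infty\},\qquad L^{1,\infty}(\mathcal H)_+=L^{1,\infty}(\mathcal H)\cap B(\mathcal H)_+,$$ and for $x\in L^{1,\infty}(\mathcal H)$ let $\gamma(x)=(\gamma_2(x),\gamma_3(x),\dots)\in\ell^\infty(\mathbb N)$. A scaling-invariant state is a positive linear form $\omega$ on the complex algebra $\ell^\infty(\mathbb N)$ with $\omega(\mathbf 1)=1$, with $\omega\big((x_{2j})_{j\ge1}\big)=\omega\big((x_j)_{j\ge1}\big)$ for all $(x_j)\in\ell^\infty$, and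 with $\omega\big((x_j)\big)=\lim_j x_j$ for each convergent sequence. For such $\omega$ define $\mathrm{Tr}_\omega:B(\mathcal H)_+\to[0,\infty]$ by $\mathrm{Tr}_\omega(x)=\omega(\gamma(x))$ for $x\in L^{1,\infty}(\mathcal H)_+$ and $\mathrm{Tr}_\omega(x)=\infty$ for all other $x\in B(\mathcal H)_+$. A trace on $B(\mathcal H)$ is a map $\tau:B(\mathcal H)_+\to[0,\infty]$ with $\tau(x+y)=\tau(x)+\tau(y)$ and $\tau(\lambda x)=\lambda\tau(x)$ for $x,y\in B(\mathcal H)_+$, $\lambda\ge0$ (where $0\cdot\infty=0$), and $\tau(x^*x)=\tau(xx^*)$ for all $x\in B(\mathcal H)$. It is singular if it vanishes on all positive operators of finite rank but does not vanish on all positive compact operators. **Theorem.** For each scaling-invariant state $\omega$ the map $\mathrm{Tr}_\omega$ (which on $L^{1,\infty}(\mathcal H)_+$ takes the finite non-negative real values $\omega(\gamma(x))$) is a singular trace on $B(\mathcal H)$. Moreover: 1. $L^{1,\infty}(\mathcal H)_+=\{x\in B(\mathcal H)_+:\ \mathrm{Tr}_\omega(x)<\infty\}$; 2. if $x\in L^{1,\infty}(\mathcal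 H)_+$ and $\lim_{n\to\infty}\gamma_n(x)$ exists, then $\mathrm{Tr}_\omega(x)=\lim_{n\to\infty}\gamma_n(x)$. -/

import Mathlib

open Filter Topology
open scoped ENNReal NNReal ComplexOrder InnerProductSpace

noncomputable section

namespace DixmierTrace

/-! ### Traces on C*-algebras -/

/-- A trace on a C*-algebra `A`: a map `A₊ → [0, ∞]` on the positive cone which is additive,
positive homogeneous (with `0 * ∞ = 0`) and satisfies `τ (x* x) = τ (x x*)` for all `x ∈ A`. -/
structure IsTrace {A : Type*} [CStarAlgebra A] [PartialOrder A] [StarOrderedRing A]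
    (τ : {x : A // 0 ≤ x} → ℝ≥0∞) : Prop where
  add : ∀ x y : {x : A // 0 ≤ x}, τ ⟨x.1 + y.1, add_nonneg x.2 y.2⟩ = τ x + τ y
  smul : ∀ (c : ℝ≥0) (x : {x : A // 0 ≤ x}),
    τ ⟨(c : ℝ) • x.1, smul_nonneg c.2 x.2⟩ = (c : ℝ≥0∞) * τ x
  star_mul_self : ∀ x : A,
    τ ⟨star x * x, star_mul_self_nonneg x⟩ = τ ⟨x * star x, mul_star_self_nonneg x⟩

/-! ### Scaling invariant states on `ℓ^∞(ℕ)`, sequences being indexed by `1, 2, 3, …` -/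

/-- The C*-algebra of bounded complex sequences `(x₁, x₂, …)` with the supremum norm. -/
abbrev EllInfty : Type := lp (fun _ : ℕ+ => ℂ) ∞

/-- Every pointwise bounded sequence is an element of `EllInfty`. -/
theorem memℓp_of_bound {f : ℕ+ → ℂ} (C : ℝ) (hf : ∀ j, ‖f j‖ ≤ C) :
    Memℓp f ∞ := by
  refine memℓp_infty ⟨C, ?_⟩
  rintro _ ⟨j, rfl⟩
  exact hf j

/-- The scaling map `s(x)_j = x_{2j}`. -/
def scaling (x : EllInfty) : EllInfty :=
  ⟨fun j => x (2 * j), memℓp_of_bound ‖x‖ fun j => lp.norm_apply_le_norm (by simp) x (2 * j)⟩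

/-- A state: a positive linear form of value `1` at the unit. -/
structure IsState (ω : EllInfty →L[ℂ] ℂ) : Prop where
  nonneg : ∀ x : EllInfty, 0 ≤ ω (star x * x)
  map_one : ω 1 = 1

/-- The set of scaling invariant states: states `ω` with `ω ∘ s = ω` which assign to every
convergent sequence its limit. -/
structure IsScalingInvariantState (ω : EllInfty →L[ℂ] ℂ) : Prop extends IsState ω where
  scaling_invariant : ∀ x : EllInfty, ω (scaling x) = ω x
  eq_lim : ∀ (x : EllInfty) (l : ℂ), Tendsto (fun j : ℕ+ => x j) atTop (𝓝 l) → ω x = l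

/-! ### Characteristic sequences and the ideal `L^{1,∞}(H)` -/

variable {H : Type*} [NormedAddCommGroup H] [InnerProductSpace ℂ H] [CompleteSpace H]

/-- `μ` is the decreasing sequence of the eigenvalues of the positive compact operator `y`, each
non-zero eigenvalue repeated according to its multiplicity (and padded by zeros if `y` has finite
rank): there is an orthonormal system `φ` with `y φₖ = μₖ φₖ`, and `y` vanishes on the orthogonal
complement of `φ`. The index is shifted by one: `μ k` is the `(k + 1)`-st eigenvalue. -/
def IsEigenvalueSequence (y : H →L[ℂ] H) (μ : ℕ → ℝ) : Prop :=
  Antitone μ ∧ (∀ k, 0 ≤ μ k) ∧ Tendsto μ atTop (𝓝 0) ∧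
    ∃ φ : ℕ → H, Orthonormal ℂ φ ∧ (∀ k, y (φ k) = (μ k : ℂ) • φ k) ∧
      ∀ ψ : H, (∀ k, ⟪φ k, ψ⟫_ℂ = 0) → y ψ = 0

open Classical in
/-- The characteristic sequence of an operator `x`: the eigenvalue sequence of `|x| = √(x* x)`.
For compact `x` on an infinite-dimensional Hilbert space it exists and is unique; it is never used
for other operators, where its value is set to `0` in the absence of an eigenvalue sequence.
Here `charSeq x k` is the `(k + 1)`-st singular value of `x`. -/
def charSeq (x : H →L[ℂ] H) : ℕ → ℝ :=
  if h : ∃ μ, IsEigenvalueSequence (CFC.abs x) μ then h.choose else 0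

theorem charSeq_nonneg (x : H →L[ℂ] H) (k : ℕ) : 0 ≤ charSeq x k := by
  unfold charSeq
  split_ifs with h
  · exact h.choose_spec.2.1 k
  · exact le_rfl

/-- `σ_n(x)`, the sum of the first `n` terms of the characteristic sequence. -/
def sigma (x : H →L[ℂ] H) (n : ℕ) : ℝ := ∑ j ∈ Finset.range n, charSeq x j

theorem sigma_nonneg (x : H →L[ℂ] H) (n : ℕ) : 0 ≤ sigma x n :=
  Finset.sum_nonneg fun j _ => charSeq_nonneg x j

/-- `γ_n(x) = σ_n(x) / log n`, of interest for `n ≥ 2`. -/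
def gamma (x : H →L[ℂ] H) (n : ℕ) : ℝ := sigma x n / Real.log n

theorem gamma_nonneg (x : H →L[ℂ] H) (n : ℕ) : 0 ≤ gamma x n :=
  div_nonneg (sigma_nonneg x n) (Real.log_natCast_nonneg n)

variable (H) in
/-- `L^{1,∞}(H)`: the compact operators `x` with `sup_{n ≥ 2} γ_n(x) < ∞`. -/
def L1Infty : Set (H →L[ℂ] H) :=
  {x | IsCompactOperator x ∧ ∃ C : ℝ, ∀ n : ℕ, 2 ≤ n → gamma x n ≤ C}

/-- The bounded sequence `γ(x) = (γ_2(x), γ_3(x), …)` of an operator `x ∈ L^{1,∞}(H)`. -/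
def gammaSeq (x : H →L[ℂ] H) (hx : x ∈ L1Infty H) : EllInfty :=
  ⟨fun j => (gamma x (j + 1) : ℂ), by
    obtain ⟨-, C, hC⟩ := hx
    refine memℓp_of_bound C fun j => ?_
    rw [Complex.norm_real, Real.norm_of_nonneg (gamma_nonneg _ _)]
    exact hC _ (Nat.succ_le_succ j.pos)⟩

/-! ### Dixmier traces -/

open Classical in
/-- The map `Tr_ω : B(H)₊ → [0, ∞]`: `Tr_ω(x) = ω(γ(x))` on the positive part of `L^{1,∞}(H)`
(for a state `ω` this number is real and non-negative), extended by `∞`. -/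
def dixmierTrace (ω : EllInfty →L[ℂ] ℂ) (x : {x : H →L[ℂ] H // 0 ≤ x}) : ℝ≥0∞ :=
  if hx : x.1 ∈ L1Infty H then ENNReal.ofReal (ω (gammaSeq x.1 hx)).re else ∞

/-- A singular trace on `B(H)`: a trace which vanishes on the positive operators of finite rank
and whose restriction to the positive compact operators is not the zero trace. (A condition
`τ ≠ 0` on all of `B(H)₊` would be weaker: extending the zero trace on the compact operators by
`∞` gives a non-zero trace on `B(H)`.) -/
structure IsSingularTrace (τ : {x : H →L[ℂ] H // 0 ≤ x} → ℝ≥0∞) : Prop extends IsTrace τ where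
  ne_zero : ∃ x : {x : H →L[ℂ] H // 0 ≤ x}, IsCompactOperator x.1 ∧ τ x ≠ 0
  finite_rank : ∀ x : {x : H →L[ℂ] H // 0 ≤ x},
    FiniteDimensional ℂ (LinearMap.range (x.1 : H →ₗ[ℂ] H)) → τ x = 0

end DixmierTrace

end

namespace DixmierTrace

/-! ### Existence of eigenvalue sequences -/

section Existence

/-! The only hard property is additivity, since $\gamma$ itself is not additive. Ky Fan's principle
says that for positive compact $x$ the number $\sigma_n(x)$ is the largest value of $\sum_{i\le
n}\langle e_i, x e_i\rangle$ over orthonormal families. This yields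
$\sigma_n(x+y)\le\sigma_n(x)+\sigma_n(y)$ and, on taking the span of both sets of leading
eigenvectors, $\sigma_n(x)+\sigma_n(y)\le\sigma_{2n}(x+y)$ (`IsEigenvalueSequence.sum_add_le`,
`IsEigenvalueSequence.add_sum_le`).

Divided by $\log n$, the first inequality makes $\omega\circ\gamma$ subadditive. As $\log 2n-\log n$
is constant, the second says that $\gamma(x)+\gamma(y)$ is at most the scaling of $\gamma(x+y)$ plus
a null sequence; $\omega$ ignores both the scaling and the null sequence, so superadditivity follows
(`IsScalingInvariantState.map_gammaSeq_add`). The value $\infty$ causes no trouble because the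
positive part of $L^{1,\infty}$ is a hereditary cone.

The trace property holds because $x^*x$ and $xx^*$ share their non-zero eigenvalues. For finite rank
$\sigma_n$ is eventually constant, so $\gamma_n\to0$; the eigenvalues $1/k$ give $\gamma_n\to1$, so
the trace is not zero on compact operators. -/

/-- A positive compact operator has a unit eigenvector whose eigenvalue is the operator norm. -/
theorem exists_unit_eigenvector_norm {E : Type*} [NormedAddCommGroup E] [InnerProductSpace ℂ E]
    [CompleteSpace E] [Nontrivial E] {T : E →L[ℂ] E} (hT : IsCompactOperator T)
    (hp : T.IsPositive) : ∃ v : E, ‖v‖ = 1 ∧ T v = ((‖T‖ : ℝ) : ℂ) • v := by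
  by_cases h0 : T = 0
  · obtain ⟨v, hv⟩ := exists_norm_eq E zero_le_one
    exact ⟨v, hv, by simp [h0]⟩
  -- Some spectral value has modulus equal to the spectral radius, which is the norm because `T` is
  -- self-adjoint. Compactness makes it an eigenvalue, and positivity of $\langle u, Tu\rangle =
  -- z\|u\|^2$ removes the phase.
  obtain ⟨z, hz, hzn⟩ := spectrum.exists_nnnorm_eq_spectralRadius T
  rw [T.spectralRadius_eq_nnnorm hp.isSelfAdjoint, ENNReal.coe_inj] at hzn
  have hz0 : z ≠ 0 := by
    rintro rfl
    rw [nnnorm_zero, eq_comm, nnnorm_eq_zero] at hzn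
    exact h0 hzn
  obtain ⟨u, hu, hu0⟩ := ((hT.hasEigenvalue_iff_mem_spectrum hz0).2 hz).exists_hasEigenvector
  have hTu : T u = z • u := Module.End.mem_eigenspace_iff.1 hu
  have hpos : 0 ≤ z * ((‖u‖ : ℂ) ^ 2) := by
    have := hp.inner_nonneg_right u
    rwa [hTu, inner_smul_right, inner_self_eq_norm_sq_to_K] at this
  have hun : (0 : ℂ) < (‖u‖ : ℂ) ^ 2 := by
    rw [← Complex.ofReal_pow, Complex.zero_lt_real]
    positivity
  have hz' : 0 ≤ z := by
    rw [← mul_inv_cancel_right₀ hun.ne' z]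
    exact mul_nonneg hpos (inv_nonneg.2 hun.le)
  have hzT : z = ((‖T‖ : ℝ) : ℂ) := by
    rw [← coe_nnnorm T, ← hzn, coe_nnnorm]
    exact Complex.eq_coe_norm_of_nonneg hz'
  refine ⟨((‖u‖ : ℂ)⁻¹) • u, ?_, ?_⟩
  · rw [norm_smul, norm_inv, Complex.norm_real, norm_norm,
      inv_mul_cancel₀ (norm_ne_zero_iff.2 hu0)]
  · rw [map_smul, hTu, hzT, smul_comm]

/-- The eigenvalues of a compact operator along an orthonormal sequence tend to zero. -/
theorem tendsto_eigenvalues_zero {H : Type*} [NormedAddCommGroup H]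
    [InnerProductSpace ℂ H] {y : H →L[ℂ] H} (hy : IsCompactOperator y) {μ : ℕ → ℝ}
    (hanti : Antitone μ) (hnn : ∀ k, 0 ≤ μ k) {φ : ℕ → H} (hφ : Orthonormal ℂ φ)
    (heig : ∀ k, y (φ k) = (μ k : ℂ) • φ k) : Tendsto μ atTop (𝓝 0) := by
  have hbdd : BddBelow (Set.range μ) := ⟨0, by rintro _ ⟨k, rfl⟩; exact hnn k⟩
  have hlim := tendsto_atTop_ciInf hanti hbdd
  set l := ⨅ k, μ k with hl
  have hle : ∀ k, l ≤ μ k := fun k => ciInf_le hbdd k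
  have hl0 : 0 ≤ l := le_ciInf hnn
  obtain ⟨K, hK, hsub⟩ := hy.image_closedBall_subset_compact (f := (y : H →ₗ[ℂ] H)) 1
  have hmem : ∀ k, y (φ k) ∈ K := fun k =>
    hsub ⟨φ k, by simp [hφ.norm_eq_one], rfl⟩
  obtain ⟨a, -, ψ, hψ, ha⟩ := hK.tendsto_subseq hmem
  rcases hl0.eq_or_lt with h | h
  · rwa [h]
  exfalso
  -- If the limit $l$ were positive, the images of distinct $\varphi_k$ would be orthogonal of norm
  -- at least $l$, hence at distance at least $l$; no subsequence could be Cauchy.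
  obtain ⟨N, hN⟩ := Metric.cauchySeq_iff'.1 ha.cauchySeq l h
  have h1 := hN (N + 1) (Nat.le_succ N)
  have hne : ψ (N + 1) ≠ ψ N := (hψ (Nat.lt_succ_self N)).ne'
  have h2 : ‖y (φ (ψ (N + 1))) - y (φ (ψ N))‖ ^ 2 = μ (ψ (N + 1)) ^ 2 + μ (ψ N) ^ 2 := by
    rw [heig, heig, @norm_sub_sq ℂ, inner_smul_left, inner_smul_right, hφ.inner_eq_zero hne]
    simp [norm_smul, hφ.norm_eq_one]
  rw [Function.comp_apply, Function.comp_apply, dist_eq_norm] at h1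
  have h3 : ‖y (φ (ψ (N + 1))) - y (φ (ψ N))‖ ^ 2 < l ^ 2 := by gcongr
  have h4 : l ^ 2 ≤ μ (ψ N) ^ 2 := by gcongr; exact hle _
  nlinarith [sq_nonneg (μ (ψ (N + 1)))]

variable {H : Type*} [NormedAddCommGroup H] [InnerProductSpace ℂ H] [CompleteSpace H]

/-- The norm-attaining eigenvector is taken for the restriction of `y` to `W`, so that `m` is the
norm of that restriction. The final bound later makes the successive eigenvalues decrease and forces
`y` to vanish on the complement of all eigenvectors. -/
theorem exists_unit_eigenvector_mem {y : H →L[ℂ] H} (hy : IsCompactOperator y)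
    (hp : y.IsPositive) {W : Submodule ℂ H} (hW : IsClosed (W : Set H)) (hW0 : W ≠ ⊥)
    (hinv : ∀ v ∈ W, y v ∈ W) :
    ∃ v ∈ W, ‖v‖ = 1 ∧ ∃ m : ℝ, 0 ≤ m ∧ y v = (m : ℂ) • v ∧ ∀ w ∈ W, ‖y w‖ ≤ m * ‖w‖ := by
  have : CompleteSpace W := hW.completeSpace_coe
  have : Nontrivial W := (Submodule.nontrivial_iff_ne_bot).2 hW0
  let T : W →L[ℂ] W := (y.comp W.subtypeL).codRestrict W fun v => hinv v v.2
  have hT : IsCompactOperator T := (hy.comp_clm W.subtypeL).codRestrict _ hW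
  have hTp : T.IsPositive := by
    rw [ContinuousLinearMap.isPositive_def]
    exact ⟨fun u v => hp.isSymmetric u v, fun v => hp.re_inner_nonneg_left v⟩
  obtain ⟨v, hv, hTv⟩ := exists_unit_eigenvector_norm hT hTp
  refine ⟨v, v.2, hv, ‖T‖, T.opNorm_nonneg, congrArg Subtype.val hTv, fun w hw => ?_⟩
  exact T.le_opNorm ⟨w, hw⟩

/-- A finite-dimensional subspace invariant under `y`. -/
structure FiniteInvariant (y : H →L[ℂ] H) where
  carrier : Submodule ℂ H
  finite : FiniteDimensional ℂ carrier
  invariant : ∀ v ∈ carrier, y v ∈ carrier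

/-- The invariant subspaces spanned successively by the eigenvectors which `f` selects. -/
noncomputable def eigenFlag {y : H →L[ℂ] H} (f : FiniteInvariant y → H) (m : FiniteInvariant y → ℝ)
    (hf : ∀ U, y (f U) = (m U : ℂ) • f U) : ℕ → FiniteInvariant y
  | 0 => ⟨⊥, inferInstance, fun v hv => by simp_all⟩
  | n + 1 =>
    let U := eigenFlag f m hf n
    have := U.finite
    ⟨U.carrier ⊔ Submodule.span ℂ {f U}, inferInstance, fun v hv => by
      obtain ⟨u, hu, w, hw, rfl⟩ := Submodule.mem_sup.1 hv
      obtain ⟨c, rfl⟩ := Submodule.mem_span_singleton.1 hw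
      rw [map_add, map_smul, hf]
      exact add_mem (Submodule.mem_sup_left (U.invariant u hu))
        (Submodule.mem_sup_right (Submodule.smul_mem _ _ (Submodule.smul_mem _ _
          (Submodule.mem_span_singleton_self _))))⟩

/-- Positive compact operators on infinite-dimensional Hilbert spaces have eigenvalue sequences. -/
theorem exists_isEigenvalueSequence (hH : ¬ FiniteDimensional ℂ H) {y : H →L[ℂ] H}
    (hy : IsCompactOperator y) (hp : y.IsPositive) : ∃ μ, IsEigenvalueSequence y μ := by
  have step : ∀ U : FiniteInvariant y, ∃ v ∈ U.carrierᗮ, ‖v‖ = 1 ∧ ∃ m : ℝ, 0 ≤ m ∧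
      y v = (m : ℂ) • v ∧ ∀ w ∈ U.carrierᗮ, ‖y w‖ ≤ m * ‖w‖ := by
    intro U
    have := U.finite
    refine exists_unit_eigenvector_mem hy hp U.carrier.isClosed_orthogonal ?_ ?_
    · intro h
      rw [Submodule.orthogonal_eq_bot_iff] at h
      have h' := U.finite
      rw [h] at h'
      exact hH (Module.Finite.equiv (Submodule.topEquiv (R := ℂ) (M := H)))
    · intro v hv u hu
      rw [← hp.inner_left_eq_inner_right]
      exact hv _ (U.invariant u hu)
  choose f hfU hfn m hm0 hfm hbound using step
  let U : ℕ → FiniteInvariant y := eigenFlag f m hfm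
  have hsucc : ∀ n, (U (n + 1)).carrier = (U n).carrier ⊔ Submodule.span ℂ {f (U n)} :=
    fun n => rfl
  have hmono : Monotone fun n => (U n).carrier :=
    monotone_nat_of_le_succ fun n => by rw [hsucc]; exact le_sup_left
  have hmem : ∀ {i j}, i < j → f (U i) ∈ (U j).carrier := fun {i j} hij =>
    hmono (Nat.succ_le_of_lt hij)
      (by change _ ∈ (U (i + 1)).carrier
          rw [hsucc]
          exact Submodule.mem_sup_right (Submodule.mem_span_singleton_self _))
  have horth : Orthonormal ℂ fun n => f (U n) := by
    refine ⟨fun n => hfn _, fun i j hij => ?_⟩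
    rcases lt_or_gt_of_ne hij with h | h
    · exact hfU _ _ (hmem h)
    · exact inner_eq_zero_symm.1 (hfU _ _ (hmem h))
  have hanti : Antitone fun n => m (U n) := by
    refine antitone_nat_of_succ_le fun n => ?_
    have h1 := hbound (U n) (f (U (n + 1)))
      (Submodule.orthogonal_le (hmono n.le_succ) (hfU (U (n + 1))))
    rw [hfm, norm_smul, hfn, mul_one, mul_one, Complex.norm_real,
      Real.norm_of_nonneg (hm0 _)] at h1
    exact h1
  have hlim := tendsto_eigenvalues_zero hy hanti (fun _ => hm0 _) horth (fun _ => hfm _)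
  refine ⟨fun n => m (U n), hanti, fun _ => hm0 _, hlim, fun n => f (U n), horth,
    fun _ => hfm _, fun ψ hψ => ?_⟩
  have hψU : ∀ n, ψ ∈ (U n).carrierᗮ := by
    intro n
    induction n with
    | zero => exact (Submodule.bot_orthogonal_eq_top (𝕜 := ℂ) (E := H)).symm ▸ Submodule.mem_top
    | succ n ih =>
      rw [hsucc, ← Submodule.inf_orthogonal]
      exact ⟨ih, Submodule.mem_orthogonal_singleton_iff_inner_right.2 (hψ n)⟩
  -- A vector orthogonal to every eigenvector lies in all complements, so
  -- $\|y\psi\|\le\mu_n\|\psi\|$ for every $n$, and $\mu_n\to0$.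
  have h0 : ‖y ψ‖ ≤ 0 * ‖ψ‖ :=
    ge_of_tendsto' (hlim.mul_const ‖ψ‖) fun n => hbound _ _ (hψU n)
  rw [zero_mul] at h0
  exact norm_le_zero_iff.1 h0

/-- An operator dominated by a positive compact operator, in the sense that
`‖T v‖² ≤ ⟨z v, v⟩`, is compact. -/
theorem isCompactOperator_of_norm_sq_le {T z : H →L[ℂ] H} (hz : IsCompactOperator z)
    (h : ∀ v, ‖T v‖ ^ 2 ≤ RCLike.re ⟪z v, v⟫_ℂ) : IsCompactOperator T := by
  rw [← ContinuousLinearMap.coe_coe,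
    isCompactOperator_iff_isCompact_closure_image_closedBall (T : H →ₗ[ℂ] H) one_pos]
  refine TotallyBounded.isCompact_of_isClosed ?_ isClosed_closure
  refine TotallyBounded.closure ?_
  have hzt : TotallyBounded ((z : H →ₗ[ℂ] H) '' Metric.closedBall 0 1) := by
    obtain ⟨K, hK, hsub⟩ := IsCompactOperator.image_closedBall_subset_compact
      (f := (z : H →ₗ[ℂ] H)) hz 1
    exact hK.totallyBounded.subset hsub
  rw [Metric.totallyBounded_iff]
  intro ε hε
  -- An $\varepsilon^2/2$-net for the image of the ball under `z` gives an $\varepsilon$-net for its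
  -- image under `T`: $\|T(v-w)\|^2\le\|z(v-w)\|\,\|v-w\|$ and $\|v-w\|\le2$.
  obtain ⟨t, hts, htf, htc⟩ := Metric.finite_approx_of_totallyBounded hzt (ε ^ 2 / 2)
    (by positivity)
  obtain ⟨s, hs, hsf, rfl⟩ := (Set.exists_subset_image_finite_and (p := (· = t))).1
    ⟨t, hts, htf, rfl⟩
  refine ⟨T '' s, hsf.image T, ?_⟩
  rintro _ ⟨v, hv, rfl⟩
  obtain ⟨w', hw', hvw⟩ := Set.mem_iUnion₂.1 (htc ⟨v, hv, rfl⟩)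
  obtain ⟨w, hw, rfl⟩ := hw'
  refine Set.mem_iUnion₂.2 ⟨T w, ⟨w, hw, rfl⟩, ?_⟩
  rw [Metric.mem_ball, dist_eq_norm] at hvw ⊢
  have h1 := hs hw
  rw [mem_closedBall_zero_iff] at hv h1
  have h2 : ‖T (v - w)‖ ^ 2 ≤ ‖z (v - w)‖ * ‖v - w‖ := (h _).trans (re_inner_le_norm _ _)
  have h3 : ‖v - w‖ ≤ 2 := (norm_sub_le _ _).trans (by linarith)
  have h4 : ‖z (v - w)‖ < ε ^ 2 / 2 := by rwa [map_sub]
  rw [ContinuousLinearMap.coe_coe, ← map_sub]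
  refine lt_of_pow_lt_pow_left₀ 2 hε.le ?_
  nlinarith [norm_nonneg (z (v - w)), norm_nonneg (v - w)]

end Existence

/-! ### Ky Fan's inequalities for the sums of eigenvalues -/

section KyFan

theorem IsEigenvalueSequence.exists_orthonormal_sum_eq {H : Type*}
    [NormedAddCommGroup H] [InnerProductSpace ℂ H] {y : H →L[ℂ] H} {μ : ℕ → ℝ}
    (hμ : IsEigenvalueSequence y μ) (n : ℕ) : ∃ e : Fin n → H, Orthonormal ℂ e ∧
      ∑ i, RCLike.re ⟪e i, y (e i)⟫_ℂ = ∑ k ∈ Finset.range n, μ k := by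
  obtain ⟨-, -, -, φ, hφ, heig, -⟩ := hμ
  refine ⟨fun i => φ i, hφ.comp _ Fin.val_injective, ?_⟩
  rw [← Fin.sum_univ_eq_sum_range]
  refine Finset.sum_congr rfl fun i _ => ?_
  rw [heig, inner_smul_right, inner_self_eq_norm_sq_to_K, hφ.norm_eq_one]
  simp

variable {H : Type*} [NormedAddCommGroup H] [InnerProductSpace ℂ H] [CompleteSpace H]

theorem hasSum_re_inner {y : H →L[ℂ] H} {μ : ℕ → ℝ} {φ : ℕ → H}
    (hφ : Orthonormal ℂ φ) (heig : ∀ k, y (φ k) = (μ k : ℂ) • φ k)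
    (hker : ∀ ψ : H, (∀ k, ⟪φ k, ψ⟫_ℂ = 0) → y ψ = 0) (v : H) :
    HasSum (fun k => μ k * ‖⟪φ k, v⟫_ℂ‖ ^ 2) (RCLike.re ⟪v, y v⟫_ℂ) := by
  have hs : Summable fun k => ⟪φ k, v⟫_ℂ • φ k :=
    (hφ.orthogonalFamily.summable_iff_norm_sq_summable fun k => ⟪φ k, v⟫_ℂ).2
      (hφ.inner_products_summable v)
  -- The sum `w` is the projection of `v` onto the closed span of `φ`; the rest of `v` is killed by
  -- `y`.
  obtain ⟨w, hw⟩ := hs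
  have hφw : ∀ j, ⟪φ j, v - w⟫_ℂ = 0 := by
    intro j
    have h1 := hw.mapL (innerSL ℂ (φ j))
    have h2 : HasSum (fun k => innerSL ℂ (φ j) (⟪φ k, v⟫_ℂ • φ k)) ⟪φ j, v⟫_ℂ := by
      convert hasSum_ite_eq j ⟪φ j, v⟫_ℂ using 2 with k
      rw [innerSL_apply_apply, inner_smul_right, orthonormal_iff_ite.1 hφ]
      by_cases h : k = j
      · rw [if_pos h, if_pos h.symm, mul_one, h]
      · rw [if_neg h, if_neg (Ne.symm h), mul_zero]
    rw [inner_sub_right, sub_eq_zero]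
    exact h2.unique h1
  have hyv : y v = y w := by
    rw [← sub_eq_zero, ← map_sub]
    exact hker _ hφw
  have h3 := (hw.mapL y).mapL (innerSL ℂ v)
  rw [hyv]
  have h4 := Complex.hasSum_re h3
  refine HasSum.congr_fun h4 fun k => ?_
  rw [innerSL_apply_apply, map_smul, heig, inner_smul_right, inner_smul_right,
    ← inner_conj_symm v (φ k)]
  rw [mul_left_comm, RCLike.mul_conj, Complex.re_ofReal_mul]
  norm_cast

/-- Ky Fan's upper bound: a partial trace over `n` orthonormal vectors is at most the sum of the
`n` largest eigenvalues. -/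
theorem IsEigenvalueSequence.sum_re_inner_le {y : H →L[ℂ] H} {μ : ℕ → ℝ}
    (hμ : IsEigenvalueSequence y μ) {ι : Type*} [Fintype ι] {e : ι → H} (he : Orthonormal ℂ e)
    {n : ℕ} (hn : Fintype.card ι ≤ n) :
    ∑ i, RCLike.re ⟪e i, y (e i)⟫_ℂ ≤ ∑ k ∈ Finset.range n, μ k := by
  obtain ⟨hanti, hnn, -, φ, hφ, heig, hker⟩ := hμ
  have h1 : HasSum (fun k => ∑ i, μ k * ‖⟪φ k, e i⟫_ℂ‖ ^ 2)
      (∑ i, RCLike.re ⟪e i, y (e i)⟫_ℂ) :=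
    hasSum_sum fun i _ => hasSum_re_inner hφ heig hker (e i)
  have h2 : HasSum (fun k => ∑ i, ‖⟪φ k, e i⟫_ℂ‖ ^ 2) (∑ i, ∑' k, ‖⟪φ k, e i⟫_ℂ‖ ^ 2) :=
    hasSum_sum fun i _ => (hφ.inner_products_summable (e i)).hasSum
  have h3 : ∑ i, ∑' k, ‖⟪φ k, e i⟫_ℂ‖ ^ 2 ≤ n := by
    calc _ ≤ ∑ i : ι, (1 : ℝ) := Finset.sum_le_sum fun i _ =>
          (hφ.tsum_inner_products_le (e i)).trans (by rw [he.norm_eq_one, one_pow])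
      _ ≤ n := by simpa using hn
  -- The weights $w_k=\sum_i|\langle\varphi_k,e_i\rangle|^2$ lie in $[0,1]$ with total at most $n$.
  -- Hence $\mu_kw_k\le(\mu_k-\mu_n)1_{k<n}+\mu_nw_k$ termwise, and the right side sums to at most
  -- $\sum_{k<n}\mu_k$.
  have h4 : HasSum (fun k => (if k ∈ Finset.range n then μ k - μ n else 0))
      (∑ k ∈ Finset.range n, (μ k - μ n)) := by
    rw [← Finset.sum_congr rfl fun k hk => if_pos hk]
    exact hasSum_sum_of_ne_finset_zero fun k hk => if_neg hk
  have h5 := h4.add (h2.mul_left (μ n))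
  refine (hasSum_le (fun k => ?_) h1 h5).trans ?_
  · rw [← Finset.mul_sum]
    have hw1 : ∑ i, ‖⟪φ k, e i⟫_ℂ‖ ^ 2 ≤ 1 := by
      have := he.sum_inner_products_le (φ k) (s := Finset.univ)
      rw [hφ.norm_eq_one, one_pow] at this
      simpa only [norm_inner_symm] using this
    have hw0 : 0 ≤ ∑ i, ‖⟪φ k, e i⟫_ℂ‖ ^ 2 := Finset.sum_nonneg fun i _ => sq_nonneg _
    split_ifs with hk
    · nlinarith [hanti (Finset.mem_range.1 hk).le]
    · rw [zero_add]
      exact mul_le_mul_of_nonneg_right (hanti (not_lt.1 (Finset.mem_range.not.1 hk))) hw0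
  · rw [Finset.sum_sub_distrib, Finset.sum_const, Finset.card_range, nsmul_eq_mul]
    nlinarith [mul_le_mul_of_nonneg_left h3 (hnn n)]

theorem IsEigenvalueSequence.sum_le_of_le {x y : H →L[ℂ] H} {μ ν : ℕ → ℝ}
    (hμ : IsEigenvalueSequence x μ) (hν : IsEigenvalueSequence y ν)
    (h : ∀ v, RCLike.re ⟪v, x v⟫_ℂ ≤ RCLike.re ⟪v, y v⟫_ℂ) (n : ℕ) :
    ∑ k ∈ Finset.range n, μ k ≤ ∑ k ∈ Finset.range n, ν k := by
  obtain ⟨e, he, hsum⟩ := hμ.exists_orthonormal_sum_eq n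
  rw [← hsum]
  exact (Finset.sum_le_sum fun i _ => h (e i)).trans
    (hν.sum_re_inner_le he (Fintype.card_fin n).le)

/-- Partial sums of eigenvalue sequences are partial traces over any finite-dimensional subspace
which contains the corresponding eigenvectors. -/
theorem sum_le_sum_re_inner {y : H →L[ℂ] H} {μ : ℕ → ℝ} (hnn : ∀ k, 0 ≤ μ k) {φ : ℕ → H}
    (hφ : Orthonormal ℂ φ) (heig : ∀ k, y (φ k) = (μ k : ℂ) • φ k)
    (hker : ∀ ψ : H, (∀ k, ⟪φ k, ψ⟫_ℂ = 0) → y ψ = 0) {V : Submodule ℂ H} {ι : Type*} [Fintype ι]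
    (b : OrthonormalBasis ι ℂ V) {n : ℕ} (hV : ∀ k < n, φ k ∈ V) :
    ∑ k ∈ Finset.range n, μ k ≤ ∑ i, RCLike.re ⟪(b i : H), y (b i)⟫_ℂ := by
  calc ∑ k ∈ Finset.range n, μ k
      = ∑ k ∈ Finset.range n, ∑ i, μ k * ‖⟪φ k, (b i : H)⟫_ℂ‖ ^ 2 := by
        refine Finset.sum_congr rfl fun k hk => ?_
        have h := b.sum_sq_norm_inner_left ⟨φ k, hV k (Finset.mem_range.1 hk)⟩
        simp only [Submodule.coe_inner, Submodule.coe_norm, hφ.norm_eq_one] at h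
        rw [← Finset.mul_sum, h, one_pow, mul_one]
    _ = ∑ i, ∑ k ∈ Finset.range n, μ k * ‖⟪φ k, (b i : H)⟫_ℂ‖ ^ 2 := Finset.sum_comm
    _ ≤ _ := Finset.sum_le_sum fun i _ => sum_le_hasSum _
        (fun k _ => mul_nonneg (hnn k) (sq_nonneg _)) (hasSum_re_inner hφ heig hker (b i))

/-- The first $n$ eigenvectors of `x` and of `y` together span a space `V` of dimension at most
$2n$. The partial trace of `x + y` over `V` dominates both sums on the left and is bounded by Ky
Fan's inequality. -/
theorem IsEigenvalueSequence.add_sum_le {x y : H →L[ℂ] H} {μ ν ρ : ℕ → ℝ}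
    (hμ : IsEigenvalueSequence x μ) (hν : IsEigenvalueSequence y ν)
    (hρ : IsEigenvalueSequence (x + y) ρ) (n : ℕ) :
    ∑ k ∈ Finset.range n, μ k + ∑ k ∈ Finset.range n, ν k ≤ ∑ k ∈ Finset.range (2 * n), ρ k := by
  obtain ⟨-, hμ0, -, φ, hφ, hφe, hφk⟩ := hμ
  obtain ⟨-, hν0, -, ψ, hψ, hψe, hψk⟩ := hν
  let g : Fin n ⊕ Fin n → H := Sum.elim (fun i => φ i) (fun i => ψ i)
  let V : Submodule ℂ H := Submodule.span ℂ (Set.range g)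
  have hVdim : FiniteDimensional ℂ V := FiniteDimensional.span_of_finite ℂ (Set.finite_range g)
  have hcard : Module.finrank ℂ V ≤ 2 * n :=
    (finrank_range_le_card g).trans (by simp [two_mul])
  let b := stdOrthonormalBasis ℂ V
  have h1 := sum_le_sum_re_inner hμ0 hφ hφe hφk b (n := n)
    fun k hk => Submodule.subset_span ⟨Sum.inl ⟨k, hk⟩, rfl⟩
  have h2 := sum_le_sum_re_inner hν0 hψ hψe hψk b (n := n)
    fun k hk => Submodule.subset_span ⟨Sum.inr ⟨k, hk⟩, rfl⟩
  have hb : Orthonormal ℂ fun i => (b i : H) := b.orthonormal.comp_linearIsometry V.subtypeₗᵢ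
  have h3 := hρ.sum_re_inner_le hb (n := 2 * n) (by simpa using hcard)
  simp only [add_apply, inner_add_right, map_add,
    Finset.sum_add_distrib] at h3
  linarith

theorem IsEigenvalueSequence.sum_add_le {x y : H →L[ℂ] H} {μ ν ρ : ℕ → ℝ}
    (hμ : IsEigenvalueSequence x μ) (hν : IsEigenvalueSequence y ν)
    (hρ : IsEigenvalueSequence (x + y) ρ) (n : ℕ) :
    ∑ k ∈ Finset.range n, ρ k ≤ ∑ k ∈ Finset.range n, μ k + ∑ k ∈ Finset.range n, ν k := by
  obtain ⟨e, he, hsum⟩ := hρ.exists_orthonormal_sum_eq n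
  rw [← hsum]
  simp only [add_apply, inner_add_right, map_add, Finset.sum_add_distrib]
  exact add_le_add (hμ.sum_re_inner_le he (Fintype.card_fin n).le)
    (hν.sum_re_inner_le he (Fintype.card_fin n).le)

/-- The non-zero eigenvalues of `x* x` are among those of `x x*`. -/
theorem IsEigenvalueSequence.sum_star_mul_self_le {x : H →L[ℂ] H} {μ ν : ℕ → ℝ}
    (hμ : IsEigenvalueSequence (star x * x) μ) (hν : IsEigenvalueSequence (x * star x) ν) (n : ℕ) :
    ∑ k ∈ Finset.range n, μ k ≤ ∑ k ∈ Finset.range n, ν k := by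
  classical
  obtain ⟨-, hμ0, -, φ, hφ, hφe, -⟩ := hμ
  have hφe' : ∀ k, star x (x (φ k)) = (μ k : ℂ) • φ k := hφe
  have hadj : ∀ u v, ⟪x u, v⟫_ℂ = ⟪u, star x v⟫_ℂ := fun u v =>
    (ContinuousLinearMap.adjoint_inner_right x u v).symm
  -- Where $\mu_k\ne0$, the vectors $x\varphi_k/\sqrt{\mu_k}$ are orthonormal, and the partial trace
  -- of $xx^*$ over them is the sum of these $\mu_k$. Zero eigenvalues must be dropped, so there may
  -- be fewer than $n$ vectors.
  let s := {k ∈ Finset.range n | μ k ≠ 0}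
  have hpos : ∀ k : s, 0 < √(μ k) := fun k =>
    Real.sqrt_pos.2 ((hμ0 k).lt_of_ne' (Finset.mem_filter.1 k.2).2)
  let e : s → H := fun k => ((√(μ k))⁻¹ : ℂ) • x (φ k)
  have he : Orthonormal ℂ e := by
    rw [orthonormal_iff_ite]
    intro i j
    simp only [e]
    rw [inner_smul_left, inner_smul_right, hadj, hφe', inner_smul_right,
      orthonormal_iff_ite.1 hφ]
    by_cases hij : i = j
    · subst hij
      have h := (hpos i).ne'
      rw [if_pos rfl, if_pos rfl, ← Real.sq_sqrt (hμ0 i), mul_one, map_inv₀, Complex.conj_ofReal,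
        Real.sqrt_sq (hpos i).le]
      have h' : ((√(μ i) : ℝ) : ℂ) ≠ 0 := by exact_mod_cast h
      push_cast
      field_simp
    · rw [if_neg hij, if_neg (fun h => hij (Subtype.ext h))]
      simp
  have hcard : Fintype.card s ≤ n := by
    rw [Fintype.card_coe]
    exact (Finset.card_filter_le _ _).trans (Finset.card_range n).le
  refine le_trans (le_of_eq ?_) (hν.sum_re_inner_le he hcard)
  rw [← Finset.sum_filter_ne_zero, ← Finset.sum_coe_sort]
  refine Finset.sum_congr rfl fun k _ => ?_
  have hk := (hpos k).ne'
  have hstar : star x (e k) = (√(μ k) : ℂ) • φ k := by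
    simp only [e, map_smul, hφe', smul_smul]
    congr 1
    have h' : ((√(μ k) : ℝ) : ℂ) ≠ 0 := by exact_mod_cast hk
    rw [inv_mul_eq_iff_eq_mul₀ h']
    norm_cast
    exact (Real.mul_self_sqrt (hμ0 k)).symm
  have h1 : ⟪e k, (x * star x) (e k)⟫_ℂ = ⟪star x (e k), star x (e k)⟫_ℂ :=
    (ContinuousLinearMap.adjoint_inner_left x (star x (e k)) (e k)).symm
  rw [h1, hstar, inner_self_eq_norm_sq_to_K, norm_smul, hφ.norm_eq_one, mul_one,
    Complex.norm_real, Real.norm_of_nonneg (hpos k).le]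
  norm_cast
  exact (Real.sq_sqrt (hμ0 k)).symm

end KyFan

/-! ### The partial sums of the characteristic sequence -/

section Sigma

variable {H : Type*} [NormedAddCommGroup H] [InnerProductSpace ℂ H]

theorem re_inner_nonneg {x : H →L[ℂ] H} (hx : 0 ≤ x) (v : H) : 0 ≤ RCLike.re ⟪v, x v⟫_ℂ :=
  ((ContinuousLinearMap.nonneg_iff_isPositive x).1 hx).re_inner_nonneg_right v

theorem isCompactOperator_of_finiteDimensional_range {x : H →L[ℂ] H}
    (hf : FiniteDimensional ℂ (LinearMap.range (x : H →ₗ[ℂ] H))) : IsCompactOperator x := by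
  let p : H →L[ℂ] LinearMap.range (x : H →ₗ[ℂ] H) :=
    x.codRestrict _ fun v => LinearMap.mem_range_self (x : H →ₗ[ℂ] H) v
  have : ProperSpace (LinearMap.range (x : H →ₗ[ℂ] H)) := FiniteDimensional.proper ℂ _
  exact (isCompactOperator_of_locallyCompactSpace_rng (Submodule.subtypeL _)).comp_clm p

theorem IsEigenvalueSequence.eq_zero_of_finrank_le {x : H →L[ℂ] H} {μ : ℕ → ℝ}
    (hμ : IsEigenvalueSequence x μ)
    (hf : FiniteDimensional ℂ (LinearMap.range (x : H →ₗ[ℂ] H))) {k : ℕ}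
    (hk : Module.finrank ℂ (LinearMap.range (x : H →ₗ[ℂ] H)) ≤ k) : μ k = 0 := by
  obtain ⟨hanti, hnn, -, φ, hφ, heig, -⟩ := hμ
  by_contra h
  have hpos : 0 < μ k := (hnn k).lt_of_ne' h
  have hmem : ∀ i : Fin (k + 1), φ i ∈ LinearMap.range (x : H →ₗ[ℂ] H) := by
    intro i
    have hi : (μ i : ℂ) ≠ 0 := by
      exact_mod_cast (hpos.trans_le (hanti (Nat.lt_succ_iff.1 i.2))).ne'
    refine ⟨(μ i : ℂ)⁻¹ • φ i, ?_⟩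
    rw [map_smul, ContinuousLinearMap.coe_coe, heig, smul_smul, inv_mul_cancel₀ hi, one_smul]
  have hli : LinearIndependent ℂ fun i : Fin (k + 1) =>
      (⟨φ i, hmem i⟩ : LinearMap.range (x : H →ₗ[ℂ] H)) :=
    LinearIndependent.of_comp (Submodule.subtype _)
      ((hφ.linearIndependent).comp _ Fin.val_injective)
  have := hli.fintype_card_le_finrank
  rw [Fintype.card_fin] at this
  omega

/-- A diagonal operator has norm at most its largest coefficient. Applied to tails, this makes the
partial sums of a diagonal operator with null coefficients Cauchy in norm. -/
theorem norm_sum_rankOne_le {φ : ℕ → H} (hφ : Orthonormal ℂ φ) {μ : ℕ → ℝ} (hanti : Antitone μ)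
    (hnn : ∀ k, 0 ≤ μ k) {s : Finset ℕ} {N : ℕ} (hs : ∀ k ∈ s, N ≤ k) :
    ‖∑ k ∈ s, (μ k : ℂ) • InnerProductSpace.rankOne ℂ (φ k) (φ k)‖ ≤ μ N := by
  refine ContinuousLinearMap.opNorm_le_bound _ (hnn N) fun v => ?_
  refine le_of_sq_le_sq ?_ (mul_nonneg (hnn N) (norm_nonneg v))
  have h1 : (∑ k ∈ s, (μ k : ℂ) • InnerProductSpace.rankOne ℂ (φ k) (φ k)) v =
      ∑ k ∈ s, ((μ k : ℂ) * ⟪φ k, v⟫_ℂ) • φ k := by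
    simp [mul_smul]
  have h2 : ‖∑ k ∈ s, ((μ k : ℂ) * ⟪φ k, v⟫_ℂ) • φ k‖ ^ 2 =
      ∑ k ∈ s, ‖(μ k : ℂ) * ⟪φ k, v⟫_ℂ‖ ^ 2 :=
    hφ.orthogonalFamily.norm_sum (fun k => (μ k : ℂ) * ⟪φ k, v⟫_ℂ) s
  rw [h1, h2, mul_pow]
  calc ∑ k ∈ s, ‖(μ k : ℂ) * ⟪φ k, v⟫_ℂ‖ ^ 2 ≤ ∑ k ∈ s, μ N ^ 2 * ‖⟪φ k, v⟫_ℂ‖ ^ 2 := by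
        refine Finset.sum_le_sum fun k hk => ?_
        rw [norm_mul, Complex.norm_real, Real.norm_of_nonneg (hnn k), mul_pow]
        have := hanti (hs k hk)
        have := hnn k
        gcongr
    _ = μ N ^ 2 * ∑ k ∈ s, ‖⟪φ k, v⟫_ℂ‖ ^ 2 := by rw [Finset.mul_sum]
    _ ≤ μ N ^ 2 * ‖v‖ ^ 2 := by
        gcongr
        exact hφ.sum_inner_products_le v

variable [CompleteSpace H]

theorem IsEigenvalueSequence.charSeq {x : H →L[ℂ] H} (hx : 0 ≤ x) {μ : ℕ → ℝ}
    (hμ : IsEigenvalueSequence x μ) : IsEigenvalueSequence x (charSeq x) := by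
  have h : ∃ μ, IsEigenvalueSequence (CFC.abs x) μ := ⟨μ, by rwa [CFC.abs_of_nonneg x hx]⟩
  rw [DixmierTrace.charSeq, dif_pos h]
  simpa only [CFC.abs_of_nonneg x hx] using h.choose_spec

/-- Ky Fan monotonicity, used in both directions for the same operator, makes the partial sums
independent of the eigenvalue sequence chosen in `charSeq`. -/
theorem IsEigenvalueSequence.sigma_eq {x : H →L[ℂ] H} (hx : 0 ≤ x) {μ : ℕ → ℝ}
    (hμ : IsEigenvalueSequence x μ) (n : ℕ) : sigma x n = ∑ k ∈ Finset.range n, μ k :=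
  le_antisymm ((hμ.charSeq hx).sum_le_of_le hμ (fun _ => le_rfl) n)
    (hμ.sum_le_of_le (hμ.charSeq hx) (fun _ => le_rfl) n)

theorem isEigenvalueSequence_charSeq (hH : ¬ FiniteDimensional ℂ H) {x : H →L[ℂ] H}
    (hx : 0 ≤ x) (hc : IsCompactOperator x) : IsEigenvalueSequence x (charSeq x) := by
  obtain ⟨μ, hμ⟩ := exists_isEigenvalueSequence hH hc
    ((ContinuousLinearMap.nonneg_iff_isPositive x).1 hx)
  exact hμ.charSeq hx

theorem sigma_smul (hH : ¬ FiniteDimensional ℂ H) {x : H →L[ℂ] H} (hx : 0 ≤ x)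
    (hc : IsCompactOperator x) {c : ℝ} (hc0 : 0 ≤ c) (n : ℕ) :
    sigma (c • x) n = c * sigma x n := by
  obtain ⟨hanti, hnn, hlim, φ, hφ, heig, hker⟩ := isEigenvalueSequence_charSeq hH hx hc
  have h : IsEigenvalueSequence (c • x) fun k => c * charSeq x k := by
    refine ⟨fun i j hij => mul_le_mul_of_nonneg_left (hanti hij) hc0,
      fun k => mul_nonneg hc0 (hnn k), by simpa using hlim.const_mul c, φ, hφ, fun k => ?_,
      fun ψ hψ => ?_⟩
    · rw [smul_apply, heig, Complex.ofReal_mul, mul_smul, ← Complex.coe_smul c]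
    · rw [smul_apply, hker ψ hψ, smul_zero]
  rw [h.sigma_eq (smul_nonneg hc0 hx), sigma, Finset.mul_sum]

/-- Positive operators dominated by compact ones are compact. -/
theorem isCompactOperator_of_add_left {x y : H →L[ℂ] H} (hx : 0 ≤ x) (hy : 0 ≤ y)
    (hc : IsCompactOperator (x + y : H →L[ℂ] H)) : IsCompactOperator x := by
  have hs : CFC.sqrt x * CFC.sqrt x = x := CFC.sqrt_mul_sqrt_self x hx
  have hsa : IsSelfAdjoint (CFC.sqrt x) := (CFC.sqrt_nonneg x).isSelfAdjoint
  -- The square root satisfies $\|\sqrt x\,v\|^2=\langle xv,v\rangle\le\langle(x+y)v,v\rangle$, so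
  -- it is compact by domination, and so is its square `x`.
  have h : IsCompactOperator (CFC.sqrt x : H →L[ℂ] H) := by
    refine isCompactOperator_of_norm_sq_le hc fun v => ?_
    have h1 : ‖CFC.sqrt x v‖ ^ 2 = RCLike.re ⟪x v, v⟫_ℂ := by
      conv_rhs => rw [← hs]
      change _ = RCLike.re ⟪CFC.sqrt x (CFC.sqrt x v), v⟫_ℂ
      rw [hsa.isSymmetric.apply_clm,
        inner_self_eq_norm_sq]
    rw [h1, add_apply, inner_add_left, map_add, le_add_iff_nonneg_right]
    exact ((ContinuousLinearMap.nonneg_iff_isPositive y).1 hy).re_inner_nonneg_left v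
  rw [← hs]
  exact h.comp_clm (CFC.sqrt x)

theorem isCompactOperator_mul_star {x : H →L[ℂ] H}
    (hc : IsCompactOperator (star x * x : H →L[ℂ] H)) :
    IsCompactOperator (x * star x : H →L[ℂ] H) := by
  have h : IsCompactOperator x := by
    refine isCompactOperator_of_norm_sq_le hc fun v => ?_
    rw [← inner_self_eq_norm_sq (𝕜 := ℂ)]
    exact (congrArg RCLike.re (ContinuousLinearMap.adjoint_inner_left x v (x v)).symm).le
  exact h.comp_clm (star x)

theorem sigma_add_le (hH : ¬ FiniteDimensional ℂ H) {x y : H →L[ℂ] H} (hx : 0 ≤ x) (hy : 0 ≤ y)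
    (hcx : IsCompactOperator x) (hcy : IsCompactOperator y) (n : ℕ) :
    sigma (x + y) n ≤ sigma x n + sigma y n :=
  (isEigenvalueSequence_charSeq hH hx hcx).sum_add_le (isEigenvalueSequence_charSeq hH hy hcy)
    (isEigenvalueSequence_charSeq hH (add_nonneg hx hy) (hcx.add hcy)) n

theorem sigma_add_sigma_le (hH : ¬ FiniteDimensional ℂ H) {x y : H →L[ℂ] H} (hx : 0 ≤ x)
    (hy : 0 ≤ y) (hcx : IsCompactOperator x) (hcy : IsCompactOperator y) (n : ℕ) :
    sigma x n + sigma y n ≤ sigma (x + y) (2 * n) :=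
  (isEigenvalueSequence_charSeq hH hx hcx).add_sum_le (isEigenvalueSequence_charSeq hH hy hcy)
    (isEigenvalueSequence_charSeq hH (add_nonneg hx hy) (hcx.add hcy)) n

theorem sigma_le_sigma_add (hH : ¬ FiniteDimensional ℂ H) {x y : H →L[ℂ] H} (hx : 0 ≤ x)
    (hy : 0 ≤ y) (hcx : IsCompactOperator x) (hcxy : IsCompactOperator (x + y : H →L[ℂ] H))
    (n : ℕ) : sigma x n ≤ sigma (x + y) n := by
  refine (isEigenvalueSequence_charSeq hH hx hcx).sum_le_of_le
    (isEigenvalueSequence_charSeq hH (add_nonneg hx hy) hcxy) (fun v => ?_) n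
  rw [add_apply, inner_add_right, map_add, le_add_iff_nonneg_right]
  exact re_inner_nonneg hy v

theorem sigma_star_mul_self (hH : ¬ FiniteDimensional ℂ H) {x : H →L[ℂ] H}
    (hc : IsCompactOperator (star x * x : H →L[ℂ] H)) (n : ℕ) :
    sigma (star x * x) n = sigma (x * star x) n := by
  have h1 := isEigenvalueSequence_charSeq hH (star_mul_self_nonneg x) hc
  have h2 := isEigenvalueSequence_charSeq hH (mul_star_self_nonneg x)
    (isCompactOperator_mul_star hc)
  refine le_antisymm (h1.sum_star_mul_self_le h2 n) ?_
  refine IsEigenvalueSequence.sum_star_mul_self_le (x := star x) ?_ ?_ n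
  · rwa [star_star]
  · rwa [star_star]

/-! ### Stability properties of $L^{1,\infty}$ -/

theorem gamma_le_gamma {x y : H →L[ℂ] H} {n : ℕ} (h : sigma x n ≤ sigma y n) :
    gamma x n ≤ gamma y n :=
  div_le_div_of_nonneg_right h (Real.log_natCast_nonneg n)

theorem mem_L1Infty_of_add_left (hH : ¬ FiniteDimensional ℂ H) {x y : H →L[ℂ] H} (hx : 0 ≤ x)
    (hy : 0 ≤ y) (h : x + y ∈ L1Infty H) : x ∈ L1Infty H := by
  obtain ⟨hc, C, hC⟩ := h
  have hcx := isCompactOperator_of_add_left hx hy hc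
  exact ⟨hcx, C, fun n hn =>
    (gamma_le_gamma (sigma_le_sigma_add hH hx hy hcx hc n)).trans (hC n hn)⟩

/-- Being both a cone and hereditary is what keeps the trace additive when one of its values is
$\infty$. -/
theorem add_mem_L1Infty_iff (hH : ¬ FiniteDimensional ℂ H) {x y : H →L[ℂ] H} (hx : 0 ≤ x)
    (hy : 0 ≤ y) : x + y ∈ L1Infty H ↔ x ∈ L1Infty H ∧ y ∈ L1Infty H := by
  refine ⟨fun h => ⟨mem_L1Infty_of_add_left hH hx hy h,
    mem_L1Infty_of_add_left hH hy hx (by rwa [add_comm])⟩, ?_⟩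
  rintro ⟨⟨hcx, C, hC⟩, hcy, D, hD⟩
  refine ⟨hcx.add hcy, C + D, fun n hn => ?_⟩
  refine le_trans ?_ (add_le_add (hC n hn) (hD n hn))
  rw [gamma, gamma, gamma, ← add_div]
  exact div_le_div_of_nonneg_right (sigma_add_le hH hx hy hcx hcy n) (Real.log_natCast_nonneg n)

theorem gamma_smul (hH : ¬ FiniteDimensional ℂ H) {x : H →L[ℂ] H} (hx : 0 ≤ x)
    (hc : IsCompactOperator x) {c : ℝ} (hc0 : 0 ≤ c) (n : ℕ) :
    gamma (c • x) n = c * gamma x n := by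
  rw [gamma, gamma, sigma_smul hH hx hc hc0, mul_div_assoc]

theorem smul_mem_L1Infty (hH : ¬ FiniteDimensional ℂ H) {x : H →L[ℂ] H} (hx : 0 ≤ x) {c : ℝ}
    (hc0 : 0 ≤ c) (h : x ∈ L1Infty H) : c • x ∈ L1Infty H := by
  obtain ⟨hc, C, hC⟩ := h
  refine ⟨hc.smul c, c * C, fun n hn => ?_⟩
  rw [gamma_smul hH hx hc hc0]
  exact mul_le_mul_of_nonneg_left (hC n hn) hc0

theorem gamma_star_mul_self (hH : ¬ FiniteDimensional ℂ H) {x : H →L[ℂ] H}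
    (hc : IsCompactOperator (star x * x : H →L[ℂ] H)) (n : ℕ) :
    gamma (star x * x) n = gamma (x * star x) n := by
  rw [gamma, gamma, sigma_star_mul_self hH hc]

theorem mul_star_mem_L1Infty (hH : ¬ FiniteDimensional ℂ H) {x : H →L[ℂ] H}
    (h : star x * x ∈ L1Infty H) : x * star x ∈ L1Infty H := by
  obtain ⟨hc, C, hC⟩ := h
  refine ⟨isCompactOperator_mul_star hc, C, fun n hn => ?_⟩
  rw [← gamma_star_mul_self hH hc]
  exact hC n hn

theorem star_mul_self_mem_L1Infty_iff (hH : ¬ FiniteDimensional ℂ H) {x : H →L[ℂ] H} :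
    star x * x ∈ L1Infty H ↔ x * star x ∈ L1Infty H := by
  refine ⟨mul_star_mem_L1Infty hH, fun h => ?_⟩
  have := mul_star_mem_L1Infty hH (x := star x) (by rwa [star_star])
  rwa [star_star] at this

theorem tendsto_log_natCast_atTop : Tendsto (fun n : ℕ => Real.log n) atTop atTop :=
  Real.tendsto_log_atTop.comp tendsto_natCast_atTop_atTop

theorem mem_L1Infty_of_tendsto {x : H →L[ℂ] H} (hc : IsCompactOperator x) {l : ℝ}
    (hl : Tendsto (fun n => gamma x n) atTop (𝓝 l)) : x ∈ L1Infty H := by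
  obtain ⟨C, hC⟩ := hl.bddAbove_range
  exact ⟨hc, C, fun n _ => hC ⟨n, rfl⟩⟩

/-! ### Operators of finite rank -/

theorem tendsto_gamma_of_finiteDimensional_range (hH : ¬ FiniteDimensional ℂ H) {x : H →L[ℂ] H}
    (hx : 0 ≤ x) (hf : FiniteDimensional ℂ (LinearMap.range (x : H →ₗ[ℂ] H))) :
    Tendsto (fun n => gamma x n) atTop (𝓝 0) := by
  have hs := isEigenvalueSequence_charSeq hH hx (isCompactOperator_of_finiteDimensional_range hf)
  set d := Module.finrank ℂ (LinearMap.range (x : H →ₗ[ℂ] H)) with hd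
  have h : Tendsto (fun n : ℕ => sigma x d / Real.log n) atTop (𝓝 0) :=
    tendsto_log_natCast_atTop.const_div_atTop _
  refine h.congr' ?_
  filter_upwards [eventually_ge_atTop d] with n hn
  rw [gamma]
  congr 1
  exact Finset.sum_subset (Finset.range_mono hn) fun k _ hk =>
    hs.eq_zero_of_finrank_le hf (not_lt.1 (Finset.mem_range.not.1 hk))

/-! ### A diagonal operator with the eigenvalues `1 / k` -/

/-- Every decreasing null sequence is the eigenvalue sequence of a positive compact operator. -/
theorem exists_nonneg_isEigenvalueSequence {φ : ℕ → H} (hφ : Orthonormal ℂ φ) {μ : ℕ → ℝ}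
    (hanti : Antitone μ) (hnn : ∀ k, 0 ≤ μ k) (hlim : Tendsto μ atTop (𝓝 0)) :
    ∃ A : H →L[ℂ] H, 0 ≤ A ∧ IsCompactOperator A ∧ IsEigenvalueSequence A μ := by
  let S : ℕ → H →L[ℂ] H := fun n =>
    ∑ k ∈ Finset.range n, (μ k : ℂ) • InnerProductSpace.rankOne ℂ (φ k) (φ k)
  have hbd : ∀ n m N, N ≤ n → n ≤ m → dist (S n) (S m) ≤ μ N := by
    intro n m N hNn hnm
    rw [dist_comm, dist_eq_norm, ← Finset.sum_Ico_eq_sub _ hnm]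
    exact norm_sum_rankOne_le hφ hanti hnn fun k hk => hNn.trans (Finset.mem_Ico.1 hk).1
  have hcauchy : CauchySeq S := by
    refine cauchySeq_of_le_tendsto_0 μ (fun n m N hn hm => ?_) hlim
    rcases le_total n m with h | h
    · exact hbd n m N hn h
    · rw [dist_comm]
      exact hbd m n N hm h
  obtain ⟨A, hA⟩ := cauchySeq_tendsto_of_complete hcauchy
  have happ : ∀ v, Tendsto (fun n => S n v) atTop (𝓝 (A v)) := fun v =>
    ((ContinuousLinearMap.apply ℂ H v).continuous.tendsto A).comp hA
  have hSv : ∀ n v, S n v = ∑ k ∈ Finset.range n, (μ k : ℂ) • ⟪φ k, v⟫_ℂ • φ k := by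
    intro n v
    simp [S]
  have hSpos : ∀ n, 0 ≤ S n := fun n => Finset.sum_nonneg fun k _ => by
    rw [ContinuousLinearMap.nonneg_iff_isPositive]
    exact (InnerProductSpace.isPositive_rankOne_self (φ k)).smul_of_nonneg
      (Complex.zero_le_real.2 (hnn k))
  have hScomp : ∀ n, IsCompactOperator (S n) := by
    intro n
    refine isCompactOperator_of_finiteDimensional_range ?_
    let V : Submodule ℂ H := Submodule.span ℂ (φ '' Finset.range n)
    have : FiniteDimensional ℂ V :=
      FiniteDimensional.span_of_finite ℂ ((Finset.finite_toSet _).image φ)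
    refine Submodule.finiteDimensional_of_le (S₂ := V) ?_
    rintro _ ⟨v, rfl⟩
    rw [ContinuousLinearMap.coe_coe, hSv]
    exact Submodule.sum_mem _ fun k hk => Submodule.smul_mem _ _ (Submodule.smul_mem _ _
      (Submodule.subset_span ⟨k, hk, rfl⟩))
  refine ⟨A, ?_, isCompactOperator_of_tendsto hA (Eventually.of_forall hScomp), hanti, hnn, hlim,
    φ, hφ, fun j => ?_, fun ψ hψ => ?_⟩
  · exact ge_of_tendsto' hA hSpos
  · refine tendsto_nhds_unique (happ (φ j)) (tendsto_const_nhds.congr' ?_)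
    filter_upwards [eventually_gt_atTop j] with n hn
    rw [hSv, Finset.sum_eq_single_of_mem j (Finset.mem_range.2 hn)]
    · rw [orthonormal_iff_ite.1 hφ, if_pos rfl, one_smul]
    · intro k _ hk
      rw [hφ.inner_eq_zero hk, zero_smul, smul_zero]
  · refine tendsto_nhds_unique (happ ψ) (tendsto_const_nhds.congr fun n => ?_)
    rw [hSv, Finset.sum_eq_zero]
    intro k _
    rw [hψ, zero_smul, smul_zero]

theorem exists_tendsto_gamma_one (hH : ¬ FiniteDimensional ℂ H) :
    ∃ A : H →L[ℂ] H, 0 ≤ A ∧ IsCompactOperator A ∧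
      Tendsto (fun n => gamma A n) atTop (𝓝 1) := by
  -- The zero operator serves only to supply an infinite orthonormal sequence in `H`.
  obtain ⟨-, -, -, -, φ, hφ, -⟩ := exists_isEigenvalueSequence hH (y := 0)
    isCompactOperator_zero ContinuousLinearMap.isPositive_zero
  have hanti : Antitone fun k : ℕ => ((k : ℝ) + 1)⁻¹ := fun i j hij => by
    dsimp only
    gcongr
  obtain ⟨A, hA, hAc, hAe⟩ := exists_nonneg_isEigenvalueSequence hφ hanti
    (fun k => by positivity) (by simpa using tendsto_one_div_add_atTop_nhds_zero_nat (𝕜 := ℝ))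
  refine ⟨A, hA, hAc, ?_⟩
  -- The difference of the harmonic number and $\log n$ converges, so dividing by $\log n$ gives
  -- $\gamma_n-1\to0$.
  have h1 := (Real.tendsto_harmonic_sub_log.div_atTop tendsto_log_natCast_atTop).add_const 1
  rw [zero_add] at h1
  refine h1.congr' ?_
  filter_upwards [eventually_gt_atTop 1] with n hn
  have hlog : Real.log n ≠ 0 := (Real.log_pos (by exact_mod_cast hn)).ne'
  rw [gamma, hAe.sigma_eq hA, harmonic]
  push_cast
  field_simp
  ring

end Sigma

/-! ### Dixmier traces -/

section State

variable {ω : EllInfty →L[ℂ] ℂ}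

/-- States are non-negative on sequences of non-negative numbers. -/
theorem IsState.nonneg_of_forall (hω : IsState ω) {f : EllInfty} (hf : ∀ j, 0 ≤ f j) : 0 ≤ ω f := by
  have hb : ∀ j, ‖((√(f j).re : ℝ) : ℂ)‖ ≤ √‖f‖ := fun j => by
    rw [Complex.norm_real, Real.norm_of_nonneg (Real.sqrt_nonneg _)]
    exact Real.sqrt_le_sqrt ((Complex.re_le_norm _).trans
      (lp.norm_apply_le_norm ENNReal.top_ne_zero f j))
  let g : EllInfty := ⟨fun j => ((√(f j).re : ℝ) : ℂ), memℓp_of_bound _ hb⟩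
  have hg : star g * g = f := by
    ext j
    change star ((√(f j).re : ℝ) : ℂ) * ((√(f j).re : ℝ) : ℂ) = f j
    have h := Complex.nonneg_iff.1 (hf j)
    rw [Complex.star_def, Complex.conj_ofReal, ← Complex.ofReal_mul, Real.mul_self_sqrt h.1]
    exact Complex.ext rfl h.2
  rw [← hg]
  exact hω.nonneg g

theorem IsState.mono (hω : IsState ω) {f g : EllInfty} (h : ∀ j, f j ≤ g j) : ω f ≤ ω g := by
  rw [← sub_nonneg, ← map_sub]
  exact hω.nonneg_of_forall fun j => sub_nonneg.2 (h j)

end State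

section Trace

variable {H : Type*} [NormedAddCommGroup H] [InnerProductSpace ℂ H] [CompleteSpace H]
  {ω : EllInfty →L[ℂ] ℂ}

theorem gammaSeq_apply {x : H →L[ℂ] H} (hx : x ∈ L1Infty H) (j : ℕ+) :
    gammaSeq x hx j = (gamma x (j + 1) : ℂ) := rfl

theorem gammaSeq_congr {x y : H →L[ℂ] H} (hx : x ∈ L1Infty H) (hy : y ∈ L1Infty H)
    (h : ∀ n, gamma x n = gamma y n) : gammaSeq x hx = gammaSeq y hy := by
  ext j
  rw [gammaSeq_apply, gammaSeq_apply, h]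

theorem IsState.gammaSeq_nonneg (hω : IsState ω) {x : H →L[ℂ] H} (hx : x ∈ L1Infty H) :
    0 ≤ ω (gammaSeq x hx) :=
  hω.nonneg_of_forall fun _ => Complex.zero_le_real.2 (gamma_nonneg _ _)

theorem IsState.coe_re_gammaSeq (hω : IsState ω) {x : H →L[ℂ] H} (hx : x ∈ L1Infty H) :
    ((ω (gammaSeq x hx)).re : ℂ) = ω (gammaSeq x hx) :=
  Complex.ext rfl (Complex.nonneg_iff.1 (hω.gammaSeq_nonneg hx)).2

theorem dixmierTrace_of_mem {x : {x : H →L[ℂ] H // 0 ≤ x}} (hx : x.1 ∈ L1Infty H) :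
    dixmierTrace ω x = ENNReal.ofReal (ω (gammaSeq x.1 hx)).re := dif_pos hx

theorem dixmierTrace_of_notMem {x : {x : H →L[ℂ] H // 0 ≤ x}} (hx : x.1 ∉ L1Infty H) :
    dixmierTrace ω x = ∞ := dif_neg hx

theorem mem_L1Infty_iff_dixmierTrace_lt_top {x : {x : H →L[ℂ] H // 0 ≤ x}} :
    x.1 ∈ L1Infty H ↔ dixmierTrace ω x < ∞ := by
  by_cases hx : x.1 ∈ L1Infty H
  · simp [hx, dixmierTrace_of_mem hx]
  · simp [hx, dixmierTrace_of_notMem hx]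

theorem IsState.coe_toReal_dixmierTrace (hω : IsState ω) {x : {x : H →L[ℂ] H // 0 ≤ x}}
    (hx : x.1 ∈ L1Infty H) :
    (((dixmierTrace ω x).toReal : ℝ) : ℂ) = ω (gammaSeq x.1 hx) := by
  rw [dixmierTrace_of_mem hx, ENNReal.toReal_ofReal
    (Complex.nonneg_iff.1 (hω.gammaSeq_nonneg hx)).1, hω.coe_re_gammaSeq hx]

theorem IsScalingInvariantState.gammaSeq_of_tendsto (hω : IsScalingInvariantState ω)
    {x : H →L[ℂ] H} (hx : x ∈ L1Infty H) {l : ℝ}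
    (hl : Tendsto (fun n => gamma x n) atTop (𝓝 l)) : ω (gammaSeq x hx) = l := by
  refine hω.eq_lim _ _ ?_
  have h : Tendsto (fun j : ℕ+ => (j : ℕ) + 1) atTop atTop :=
    tendsto_add_atTop_nat 1 |>.comp tendsto_PNat_val_atTop_atTop
  exact (Complex.continuous_ofReal.tendsto l).comp (hl.comp h)

theorem IsScalingInvariantState.dixmierTrace_of_tendsto (hω : IsScalingInvariantState ω)
    {x : {x : H →L[ℂ] H // 0 ≤ x}} (hc : IsCompactOperator x.1) {l : ℝ}
    (hl : Tendsto (fun n => gamma x.1 n) atTop (𝓝 l)) :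
    dixmierTrace ω x = ENNReal.ofReal l := by
  have hx := mem_L1Infty_of_tendsto hc hl
  rw [dixmierTrace_of_mem hx, hω.gammaSeq_of_tendsto hx hl, Complex.ofReal_re]

/-- Up to a null sequence, `γ(x) + γ(y)` is dominated by the scaling of `γ(x + y)`. -/
theorem exists_gamma_add_gamma_le (hH : ¬ FiniteDimensional ℂ H) {x y : H →L[ℂ] H} (hx : 0 ≤ x)
    (hy : 0 ≤ y) (h : x + y ∈ L1Infty H) : ∃ K : ℝ, 0 ≤ K ∧ ∀ j : ℕ, 1 ≤ j →
      gamma x (j + 1) + gamma y (j + 1) ≤ gamma (x + y) (2 * j + 1) + K / Real.log (j + 1) := by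
  obtain ⟨⟨hcx, -⟩, hcy, -⟩ := (add_mem_L1Infty_iff hH hx hy).1 h
  obtain ⟨hc, C, hC⟩ := h
  have hC0 : 0 ≤ C := (gamma_nonneg _ _).trans (hC 2 le_rfl)
  have hlog2 : 0 ≤ Real.log 2 := Real.log_nonneg one_le_two
  have hanti := (isEigenvalueSequence_charSeq hH (add_nonneg hx hy) hc).1
  -- Two errors enter the constant: $\log(2j+1)\le\log2+\log(j+1)$ costs at most $C\log2$, and
  -- passing from $\sigma_{2j+2}$ to $\sigma_{2j+1}$ costs at most the largest eigenvalue. The index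
  -- $2j+1$ is forced because entry $j$ of the sequence is $\gamma_{j+1}$, so that scaling yields
  -- $\gamma_{2j+1}$.
  refine ⟨C * Real.log 2 + charSeq (x + y) 0,
    add_nonneg (mul_nonneg hC0 hlog2) (charSeq_nonneg _ _), fun j hj => ?_⟩
  have hj' : (1 : ℝ) ≤ j := by exact_mod_cast hj
  have hL : 0 < Real.log ((j : ℝ) + 1) := Real.log_pos (by linarith)
  have hM : 0 < Real.log ((2 * j + 1 : ℕ) : ℝ) := Real.log_pos (by push_cast; linarith)
  have hML : Real.log ((2 * j + 1 : ℕ) : ℝ) ≤ Real.log 2 + Real.log ((j : ℝ) + 1) := by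
    rw [← Real.log_mul two_ne_zero (by positivity)]
    exact Real.log_le_log (by positivity) (by push_cast; linarith)
  have h1 := sigma_add_sigma_le hH hx hy hcx hcy (j + 1)
  have h2 : sigma (x + y) (2 * (j + 1)) ≤ sigma (x + y) (2 * j + 1) + charSeq (x + y) 0 := by
    rw [show 2 * (j + 1) = (2 * j + 1) + 1 by ring, sigma, Finset.sum_range_succ]
    exact add_le_add le_rfl (hanti (Nat.zero_le _))
  have h3 : sigma (x + y) (2 * j + 1) =
      gamma (x + y) (2 * j + 1) * Real.log ((2 * j + 1 : ℕ) : ℝ) :=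
    (div_mul_cancel₀ _ hM.ne').symm
  have hg0 := gamma_nonneg (x + y) (2 * j + 1)
  have hgC := hC (2 * j + 1) (by omega)
  rw [gamma, gamma, ← add_div, div_le_iff₀ (by exact_mod_cast hL)]
  push_cast at h1 h2 h3 hML ⊢
  rw [add_mul, div_mul_cancel₀ _ hL.ne']
  nlinarith [mul_le_mul_of_nonneg_left hML hg0, mul_le_mul_of_nonneg_right hgC hlog2]

theorem IsScalingInvariantState.map_gammaSeq_add (hH : ¬ FiniteDimensional ℂ H)
    (hω : IsScalingInvariantState ω) {x y : H →L[ℂ] H} (hx : 0 ≤ x) (hy : 0 ≤ y)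
    (hx' : x ∈ L1Infty H) (hy' : y ∈ L1Infty H) (hxy : x + y ∈ L1Infty H) :
    ω (gammaSeq (x + y) hxy) = ω (gammaSeq x hx') + ω (gammaSeq y hy') := by
  refine le_antisymm ?_ ?_
  · rw [← map_add]
    refine hω.toIsState.mono fun j => ?_
    change (gamma (x + y) (j + 1) : ℂ) ≤ (gamma x (j + 1) : ℂ) + (gamma y (j + 1) : ℂ)
    rw [← Complex.ofReal_add, Complex.real_le_real, gamma, gamma, gamma, ← add_div]
    exact div_le_div_of_nonneg_right (sigma_add_le hH hx hy hx'.1 hy'.1 _)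
      (Real.log_natCast_nonneg _)
  · obtain ⟨K, hK, hle⟩ := exists_gamma_add_gamma_le hH hx hy hxy
    have hb : ∀ j : ℕ+, ‖((K / Real.log ((j : ℕ) + 1) : ℝ) : ℂ)‖ ≤ K / Real.log 2 := fun j => by
      have hj : (1 : ℝ) ≤ (j : ℕ) := by exact_mod_cast j.pos
      have h2 : 0 < Real.log 2 := Real.log_pos one_lt_two
      have hlog : Real.log 2 ≤ Real.log ((j : ℕ) + 1) :=
        Real.log_le_log two_pos (by linarith)
      rw [Complex.norm_real, Real.norm_of_nonneg (div_nonneg hK (h2.le.trans hlog))]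
      gcongr
    let δ : EllInfty := ⟨fun j => ((K / Real.log ((j : ℕ) + 1) : ℝ) : ℂ), memℓp_of_bound _ hb⟩
    have hδ : ω δ = 0 := by
      refine hω.eq_lim δ 0 ?_
      have h : Tendsto (fun j : ℕ+ => ((j : ℕ) : ℝ) + 1) atTop atTop :=
        tendsto_atTop_add_const_right _ _
          (tendsto_natCast_atTop_atTop.comp tendsto_PNat_val_atTop_atTop)
      have h' := (Real.tendsto_log_atTop.comp h).const_div_atTop K
      have h0 := (Complex.continuous_ofReal.tendsto 0).comp h'
      rwa [Complex.ofReal_zero] at h0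
    -- Replacing $\gamma(x+y)$ by its scaling and adding the null sequence `δ` leaves the value of
    -- `ω` unchanged; what remains is a termwise comparison.
    rw [← hω.scaling_invariant (gammaSeq (x + y) hxy), ← add_zero (ω (scaling _)), ← hδ,
      ← map_add, ← map_add]
    refine hω.toIsState.mono fun j => ?_
    change (gamma x (j + 1) : ℂ) + (gamma y (j + 1) : ℂ) ≤
      (gamma (x + y) (((2 * j : ℕ+) : ℕ) + 1) : ℂ) + ((K / Real.log ((j : ℕ) + 1) : ℝ) : ℂ)
    rw [← Complex.ofReal_add, ← Complex.ofReal_add, Complex.real_le_real]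
    exact hle j j.pos

theorem IsScalingInvariantState.dixmierTrace_smul (hH : ¬ FiniteDimensional ℂ H)
    (hω : IsScalingInvariantState ω) {c : ℝ} (hc : 0 ≤ c) {x : H →L[ℂ] H} (hx : 0 ≤ x) :
    dixmierTrace ω ⟨c • x, smul_nonneg hc hx⟩ = ENNReal.ofReal c * dixmierTrace ω ⟨x, hx⟩ := by
  by_cases h : x ∈ L1Infty H
  · have h' := smul_mem_L1Infty hH hx hc h
    have hg : gammaSeq (c • x) h' = (c : ℂ) • gammaSeq x h := by
      ext j
      change (gamma (c • x) (j + 1) : ℂ) = (c : ℂ) * (gamma x (j + 1) : ℂ)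
      rw [gamma_smul hH hx h.1 hc, Complex.ofReal_mul]
    rw [dixmierTrace_of_mem (x := ⟨c • x, _⟩) h', dixmierTrace_of_mem (x := ⟨x, hx⟩) h, hg,
      map_smul, smul_eq_mul, Complex.re_ofReal_mul, ENNReal.ofReal_mul hc]
  rw [dixmierTrace_of_notMem (x := ⟨x, hx⟩) h]
  -- For $c=0$ the convention $0\cdot\infty=0$ requires the trace of the zero operator to vanish;
  -- for $c>0$, rescaling by $c^{-1}$ shows that $cx$ also lies outside $L^{1,\infty}$.
  rcases hc.eq_or_lt with rfl | hc'
  · have h0 : Tendsto (fun n => gamma ((0 : ℝ) • x) n) atTop (𝓝 0) := by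
      rw [zero_smul]
      refine tendsto_gamma_of_finiteDimensional_range hH le_rfl ?_
      rw [ContinuousLinearMap.toLinearMap_zero, LinearMap.range_zero]
      infer_instance
    have hc0 : IsCompactOperator ((0 : ℝ) • x : H →L[ℂ] H) := by
      rw [zero_smul]
      exact isCompactOperator_zero
    rw [hω.dixmierTrace_of_tendsto (x := ⟨(0 : ℝ) • x, _⟩) hc0 h0, ENNReal.ofReal_zero, zero_mul]
  · have h' : c • x ∉ L1Infty H := fun h' => h <| by
      have := smul_mem_L1Infty hH (smul_nonneg hc hx) (inv_nonneg.2 hc) h'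
      rwa [smul_smul, inv_mul_cancel₀ hc'.ne', one_smul] at this
    rw [dixmierTrace_of_notMem (x := ⟨c • x, _⟩) h', ENNReal.mul_top]
    exact (ENNReal.ofReal_pos.2 hc').ne'

theorem IsScalingInvariantState.isTrace_dixmierTrace (hH : ¬ FiniteDimensional ℂ H)
    (hω : IsScalingInvariantState ω) :
    IsTrace (dixmierTrace ω : {x : H →L[ℂ] H // 0 ≤ x} → ℝ≥0∞) where
  add := by
    rintro ⟨x, hx⟩ ⟨y, hy⟩
    by_cases h : x + y ∈ L1Infty H
    · obtain ⟨hx', hy'⟩ := (add_mem_L1Infty_iff hH hx hy).1 h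
      rw [dixmierTrace_of_mem h, dixmierTrace_of_mem hx', dixmierTrace_of_mem hy',
        hω.map_gammaSeq_add hH hx hy hx' hy' h, Complex.add_re, ENNReal.ofReal_add]
      · exact (Complex.nonneg_iff.1 (hω.gammaSeq_nonneg hx')).1
      · exact (Complex.nonneg_iff.1 (hω.gammaSeq_nonneg hy')).1
    · rw [dixmierTrace_of_notMem h]
      rw [add_mem_L1Infty_iff hH hx hy, not_and_or] at h
      rcases h with h | h
      · rw [dixmierTrace_of_notMem (x := ⟨x, hx⟩) h, top_add]
      · rw [dixmierTrace_of_notMem (x := ⟨y, hy⟩) h, add_top]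
  smul c x := by
    rw [← ENNReal.ofReal_coe_nnreal]
    exact hω.dixmierTrace_smul hH c.coe_nonneg x.2
  star_mul_self := by
    intro x
    by_cases h : star x * x ∈ L1Infty H
    · have h' := (star_mul_self_mem_L1Infty_iff hH).1 h
      rw [dixmierTrace_of_mem (x := ⟨_, star_mul_self_nonneg x⟩) h,
        dixmierTrace_of_mem (x := ⟨_, mul_star_self_nonneg x⟩) h',
        gammaSeq_congr h h' (gamma_star_mul_self hH h.1)]
    · rw [dixmierTrace_of_notMem (x := ⟨_, star_mul_self_nonneg x⟩) h,
        dixmierTrace_of_notMem (x := ⟨_, mul_star_self_nonneg x⟩) fun h' => h ((star_mul_self_mem_L1Infty_iff hH).2 h')]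

theorem IsScalingInvariantState.isSingularTrace_dixmierTrace (hH : ¬ FiniteDimensional ℂ H)
    (hω : IsScalingInvariantState ω) :
    IsSingularTrace (dixmierTrace ω : {x : H →L[ℂ] H // 0 ≤ x} → ℝ≥0∞) where
  toIsTrace := hω.isTrace_dixmierTrace hH
  ne_zero := by
    obtain ⟨A, hA, hc, hl⟩ := exists_tendsto_gamma_one hH
    refine ⟨⟨A, hA⟩, hc, ?_⟩
    rw [hω.dixmierTrace_of_tendsto (x := ⟨A, hA⟩) hc hl]
    simp
  finite_rank := by
    intro x hf
    rw [hω.dixmierTrace_of_tendsto (x := x) (isCompactOperator_of_finiteDimensional_range hf)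
      (tendsto_gamma_of_finiteDimensional_range hH x.2 hf), ENNReal.ofReal_zero]

end Trace

end DixmierTrace

theorem mainTheorem2 {H : Type*} [NormedAddCommGroup H] [InnerProductSpace ℂ H] [CompleteSpace H]
    [TopologicalSpace.SeparableSpace H] (hH : ¬ FiniteDimensional ℂ H)
    (ω : DixmierTrace.EllInfty →L[ℂ] ℂ) (hω : DixmierTrace.IsScalingInvariantState ω) :
    -- `Tr_ω` is given by `ω(γ(x))` on the positive part of `L^{1,∞}(H)`
    (∀ (x : {x : H →L[ℂ] H // 0 ≤ x}) (hx : x.1 ∈ DixmierTrace.L1Infty H),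
      (((DixmierTrace.dixmierTrace ω x).toReal : ℝ) : ℂ) =
        ω (DixmierTrace.gammaSeq x.1 hx)) ∧
    -- it is a singular trace on `B(H)`
    DixmierTrace.IsSingularTrace
      (DixmierTrace.dixmierTrace ω : {x : H →L[ℂ] H // 0 ≤ x} → ℝ≥0∞) ∧
    -- its finite positive elements are exactly those of `L^{1,∞}(H)`
    (∀ x : {x : H →L[ℂ] H // 0 ≤ x},
      x.1 ∈ DixmierTrace.L1Infty H ↔ DixmierTrace.dixmierTrace ω x < ∞) ∧
    -- it is the limit of `γ_n(x)` whenever this limit exists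
    (∀ x : {x : H →L[ℂ] H // 0 ≤ x}, x.1 ∈ DixmierTrace.L1Infty H →
      ∀ l : ℝ, Tendsto (fun n : ℕ => DixmierTrace.gamma x.1 n) atTop (𝓝 l) →
        (DixmierTrace.dixmierTrace ω x).toReal = l) := by
  refine ⟨fun x hx => hω.coe_toReal_dixmierTrace hx, hω.isSingularTrace_dixmierTrace hH,
    fun x => DixmierTrace.mem_L1Infty_iff_dixmierTrace_lt_top, fun x hx l hl => ?_⟩
  rw [hω.dixmierTrace_of_tendsto hx.1 hl, ENNReal.toReal_ofReal]
  exact ge_of_tendsto' hl fun n => DixmierTrace.gamma_nonneg _ n
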